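/- Let $q=2^t$ with $t\ge 2$ even, and let $n\ge 4$ be even. A cap in the $n$-dimensional affine space $AG(n,q)$ over the field with $q$ elements is a set of points no three of which are collinear; a cap is complete if it is maximal with respect to set-theoretical inclusion among the caps of $AG(n,q)$. Then $AG(n,q)$ contains a complete cap of size $2\,(\sqrt q)^{\,n-1}$. Moreover, every complete cap in $AG(n,q)$ has size at least $\sqrt2\,(\sqrt q)^{\,n-1}$ (the trivial lower bound), so this bound is attained up to a factor of $\sqrt 2$. -/

import Mathlib

/-- A cap in an affine space over `F`: a set of points no three (distinct) of which are
collinear. -/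
def IsCap (F : Type*) {V P : Type*} [Field F] [AddCommGroup V] [Module F V] [AddTorsor V P]
    (K : Set P) : Prop :=
  ∀ a ∈ K, ∀ b ∈ K, ∀ c ∈ K, a ≠ b → a ≠ c → b ≠ c → ¬ Collinear F {a, b, c}

/-- A complete cap: a cap which is maximal with respect to set-theoretical inclusion. -/
def IsCompleteCap (F : Type*) {V P : Type*} [Field F] [AddCommGroup V] [Module F V]
    [AddTorsor V P] (K : Set P) : Prop :=
  Maximal (IsCap F) K

/-! ### Secants, completeness and the counting bound -/

section Caps

variable {F V : Type*} [Field F] [AddCommGroup V] [Module F V]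

/-! The cap is two parallel copies {0, 1} × U of an additive subgroup U of F^(n-1) with |U|² =
q^(n-1), where U meets each line through 0 in at most two vectors (`IsMaxScattered`). Scatteredness
makes each layer a cap, and a secant joining the layers meets them nowhere else. For c ≠ 0, 1 it
also makes (a, b) ↦ a + c b injective on U × U, so U + cU is everything and every point lies on a
secant.

Such U are closed under direct sums, so ranks 2 and 3 give every odd rank n - 1. Rank 2 is the graph
of squaring. In rank 3, with L the subfield of order √q and F = L + wL, take U = {x + w f(x)} for a
semilinear f on L³ that leaves no line or plane invariant.

The lower bound counts points on secants (`IsCompleteCap.two_mul_card_le`). -/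

theorem exists_eq_add_smul_of_collinear {a b c : V} (hab : a ≠ b)
    (h : Collinear F {a, b, c}) : ∃ l : F, c = a + l • (b - a) := by
  obtain ⟨v, hv⟩ := (collinear_iff_of_mem (k := F) (show a ∈ ({a, b, c} : Set V) by simp)).1 h
  obtain ⟨r, hr⟩ := hv b (by simp)
  obtain ⟨r', hr'⟩ := hv c (by simp)
  simp only [vadd_eq_add] at hr hr'
  have hr0 : r ≠ 0 := by
    rintro rfl
    exact hab (by simp [hr])
  refine ⟨r' / r, ?_⟩
  rw [hr, hr', add_sub_cancel_right, smul_smul, div_mul_cancel₀ _ hr0, add_comm]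

theorem collinear_add_smul_sub (a b : V) (l : F) : Collinear F {a, b, a + l • (b - a)} := by
  refine (collinear_iff_of_mem (k := F) (p₀ := a) (by simp)).2 ⟨b - a, ?_⟩
  rintro p (rfl | rfl | rfl)
  · exact ⟨0, by simp⟩
  · exact ⟨1, by simp⟩
  · exact ⟨l, by simp [add_comm]⟩

theorem isCap_iff {K : Set V} :
    IsCap F K ↔ ∀ a ∈ K, ∀ b ∈ K, a ≠ b → ∀ l : F, a + l • (b - a) ∈ K → l = 0 ∨ l = 1 := by
  constructor
  · intro h a ha b hb hab l hl
    by_contra! hl'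
    refine h a ha b hb _ hl hab ?_ ?_ (collinear_add_smul_sub a b l)
    · intro h'
      have : l • (b - a) = 0 := by simpa using h'.symm
      rcases smul_eq_zero.1 this with h1 | h1
      · exact hl'.1 h1
      · exact hab (sub_eq_zero.1 h1).symm
    · intro h'
      have : (l - 1) • (b - a) = 0 := by
        rw [sub_smul, one_smul, sub_eq_zero, eq_sub_iff_add_eq, add_comm]
        exact h'.symm
      rcases smul_eq_zero.1 this with h1 | h1
      · exact hl'.2 (sub_eq_zero.1 h1)
      · exact hab (sub_eq_zero.1 h1).symm
  · intro h a ha b hb c hc hab hac hbc hcol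
    obtain ⟨l, rfl⟩ := exists_eq_add_smul_of_collinear hab hcol
    rcases h a ha b hb hab l hc with rfl | rfl
    · simp at hac
    · simp at hbc

theorem isCompleteCap_iff {K : Set V} :
    IsCompleteCap F K ↔ IsCap F K ∧
      ∀ w ∉ K, ∃ a ∈ K, ∃ b ∈ K, a ≠ b ∧ ∃ l : F, w = a + l • (b - a) := by
  constructor
  · intro h
    refine ⟨h.1, fun w hw => ?_⟩
    by_contra! hno
    have hno' : ∀ a ∈ K, ∀ b ∈ K, a ≠ b → ¬ Collinear F {a, b, w} := fun a ha b hb hab hcol => by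
      obtain ⟨l, hl⟩ := exists_eq_add_smul_of_collinear hab hcol
      exact hno a ha b hb hab l hl
    refine hw (h.2 (y := insert w K) ?_ (Set.subset_insert _ _) (Set.mem_insert _ _))
    rintro a (rfl | ha) b (rfl | hb) c (rfl | hc) hab hac hbc hcol
    · exact hab rfl
    · exact hab rfl
    · exact hac rfl
    · exact hno' b hb c hc hbc
        (by rwa [show ({b, c, a} : Set V) = {a, b, c} by ext; simp; tauto])
    · exact hbc rfl
    · exact hno' a ha c hc hac
        (by rwa [show ({a, c, b} : Set V) = {a, b, c} by ext; simp; tauto])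
    · exact hno' a ha b hb hab hcol
    · exact h.1 a ha b hb c hc hab hac hbc hcol
  · rintro ⟨hcap, hex⟩
    refine ⟨hcap, fun K' hK' hle w hw => ?_⟩
    by_contra hwK
    obtain ⟨a, ha, b, hb, hab, l, rfl⟩ := hex w hwK
    rcases isCap_iff.1 hK' a (hle ha) b (hle hb) hab l hw with rfl | rfl
    · exact hwK (by simpa using ha)
    · exact hwK (by simpa using hb)

/-- Each point off K lies on a secant, and each secant has q - 2 further points. Ordered pairs count
each secant twice, so with k = |K|, 2(|V| - k) ≤ (k² - k)(q - 2). -/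
theorem IsCompleteCap.two_mul_card_le [Fintype F] [Finite V] {K : Set V}
    (h : IsCompleteCap F K) (hq : 2 ≤ Fintype.card F) :
    2 * Nat.card V ≤ K.ncard ^ 2 * Fintype.card F := by
  classical
  have := Fintype.ofFinite V
  obtain ⟨-, hex⟩ := isCompleteCap_iff.1 h
  set A : Finset V := K.toFinset with hA
  have hcard : K.ncard = A.card := Set.ncard_eq_toFinset_card' K
  set T : Finset ((V × V) × F) := A.offDiag ×ˢ ({0, 1} : Finset F)ᶜ with hT
  let g : (V × V) × F → V := fun p => p.1.1 + p.2 • (p.1.2 - p.1.1)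
  have hfib : ∀ w ∈ Aᶜ, 2 ≤ (T.filter fun p => g p = w).card := by
    intro w hw
    have hwK : w ∉ K := by simpa [hA] using hw
    obtain ⟨a, ha, b, hb, hab, l, rfl⟩ := hex w hwK
    have hl0 : l ≠ 0 := by rintro rfl; exact hwK (by simpa using ha)
    have hl1 : l ≠ 1 := by rintro rfl; exact hwK (by simpa using hb)
    -- Reversing the secant replaces the parameter l by 1 - l.
    rw [← Finset.card_pair (a := ((a, b), l)) (b := ((b, a), 1 - l)) (by simp [hab])]
    refine Finset.card_le_card ?_
    intro p hp
    simp only [Finset.mem_insert, Finset.mem_singleton] at hp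
    have hl1' : 1 - l ≠ 0 := sub_ne_zero.2 hl1.symm
    rcases hp with rfl | rfl
    · simp [hT, hA, ha, hb, hab, hl0, hl1, g]
    · simp only [hT, hA, ha, hb, hab.symm, hl1', g, Finset.mem_filter, Finset.mem_product,
        Finset.mem_offDiag, Set.mem_toFinset, Finset.mem_compl, Finset.mem_insert,
        Finset.mem_singleton, true_and, ne_eq, not_false_eq_true, not_or]
      refine ⟨by simpa using hl0, ?_⟩
      module
  have hle : Aᶜ.card * 2 ≤ T.card := by
    calc Aᶜ.card * 2 ≤ ∑ w ∈ Aᶜ, (T.filter fun p => g p = w).card := by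
          rw [← smul_eq_mul]; exact Finset.card_nsmul_le_sum _ _ _ hfib
      _ ≤ T.card := by
          rw [← Finset.card_biUnion]
          · exact Finset.card_le_card (Finset.biUnion_subset.2 fun _ _ => Finset.filter_subset _ _)
          · intro x _ y _ hxy
            refine Finset.disjoint_left.2 fun p hp hp' => hxy ?_
            rw [← (Finset.mem_filter.1 hp).2, (Finset.mem_filter.1 hp').2]
  have hTc : T.card = (A.card * A.card - A.card) * (Fintype.card F - 2) := by
    rw [hT, Finset.card_product, Finset.offDiag_card, Finset.card_compl,
      Finset.card_pair zero_ne_one]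
  rw [hTc, Finset.card_compl] at hle
  rw [hcard, Nat.card_eq_fintype_card]
  have hAV : A.card ≤ Fintype.card V := Finset.card_le_univ A
  obtain ⟨r, hr⟩ := Nat.exists_eq_add_of_le hq
  obtain ⟨s, hs⟩ := Nat.exists_eq_add_of_le hAV
  have hk : A.card ≤ A.card * A.card := Nat.le_mul_self _
  obtain ⟨d, hd⟩ := Nat.exists_eq_add_of_le hk
  rw [hr, hd, hs, Nat.add_sub_cancel_left, Nat.add_sub_cancel_left, Nat.add_sub_cancel_left] at hle
  rw [hr, hs, sq]
  nlinarith

end Caps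

/-! ### Scattered subgroups and the doubled cap -/

/-- A maximum scattered additive subgroup: it meets every line through the origin in at most two
vectors, and its order is the square root of that of the ambient space. -/
def IsMaxScattered (F : Type*) {V : Type*} [Field F] [AddCommGroup V] [Module F V]
    (U : AddSubgroup V) : Prop :=
  (∀ u ∈ U, ∀ c : F, c • u ∈ U → u = 0 ∨ c = 0 ∨ c = 1) ∧ Nat.card U ^ 2 = Nat.card V

section Scattered

variable {F V W : Type*} [Field F] [AddCommGroup V] [Module F V] [AddCommGroup W] [Module F W]

/-- If a + c b = a' + c b', then b - b' and c(b - b') both lie in U, forcing b = b'. Injectivity and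
|U|² = |V| give surjectivity. -/
theorem IsMaxScattered.exists_eq_add_smul [Finite V] {U : AddSubgroup V}
    (hU : IsMaxScattered F U) {c : F} (h0 : c ≠ 0) (h1 : c ≠ 1) (w : V) :
    ∃ a ∈ U, ∃ b ∈ U, w = a + c • b := by
  let g : U × U → V := fun p => p.1 + c • (p.2 : V)
  have hinj : Function.Injective g := by
    rintro ⟨a, b⟩ ⟨a', b'⟩ h
    have h' : c • ((b : V) - b') = a' - a := by
      rw [smul_sub, sub_eq_sub_iff_add_eq_add, add_comm, add_comm (a' : V)]
      simpa [g, add_comm] using h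
    have hb : (b : V) - b' = 0 := by
      rcases hU.1 _ (U.sub_mem b.2 b'.2) c (h' ▸ U.sub_mem a'.2 a.2) with h | h | h
      · exact h
      · exact absurd h h0
      · exact absurd h h1
    rw [hb, smul_zero] at h'
    exact Prod.ext (Subtype.ext (sub_eq_zero.1 h'.symm).symm) (Subtype.ext (sub_eq_zero.1 hb))
  have hbij := hinj.bijective_of_nat_card_le (by rw [Nat.card_prod, ← sq, hU.2])
  obtain ⟨⟨a, b⟩, rfl⟩ := hbij.2 w
  exact ⟨a, a.2, b, b.2, rfl⟩

theorem IsMaxScattered.map {U : AddSubgroup V} (hU : IsMaxScattered F U) (e : V ≃ₗ[F] W) :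
    IsMaxScattered F (U.map e.toAddEquiv.toAddMonoidHom) := by
  constructor
  · rintro _ ⟨u, hu, rfl⟩ c ⟨v, hv, hvu⟩
    have : v = c • u := e.injective (by simpa using hvu)
    rcases hU.1 u hu c (this ▸ hv) with rfl | h | h
    · simp
    · exact Or.inr (Or.inl h)
    · exact Or.inr (Or.inr h)
  · rw [← Nat.card_congr e.toEquiv, ← hU.2]
    congr 1
    exact (Nat.card_congr (U.equivMapOfInjective _ e.toAddEquiv.injective).toEquiv).symm

theorem IsMaxScattered.prod {U : AddSubgroup V} {U' : AddSubgroup W} (hU : IsMaxScattered F U)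
    (hU' : IsMaxScattered F U') : IsMaxScattered F (U.prod U') := by
  constructor
  · rintro ⟨u, v⟩ ⟨hu, hv⟩ c ⟨hcu, hcv⟩
    rcases hU.1 u hu c hcu with h | h
    · rcases hU'.1 v hv c hcv with h' | h'
      · exact Or.inl (Prod.ext h h')
      · exact Or.inr h'
    · exact Or.inr h
  · rw [Nat.card_congr (AddSubgroup.prodEquiv U U').toEquiv, Nat.card_prod, Nat.card_prod,
      mul_pow, hU.2, hU'.2]

-- On the graph of squaring, (cx)² = cx² with x ≠ 0 forces c² = c.
variable (F) in
theorem exists_isMaxScattered_prod_self [CharP F 2] :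
    ∃ U : AddSubgroup (F × F), IsMaxScattered F U := by
  let φ : F →+ F × F := (AddMonoidHom.id F).prod (frobenius F 2).toAddMonoidHom
  have hφ : Function.Injective φ := fun x y h => congrArg Prod.fst h
  refine ⟨φ.range, ?_, ?_⟩
  · rintro _ ⟨x, rfl⟩ c ⟨y, hy⟩
    have h1 : y = c * x := congrArg Prod.fst hy
    have h2 : y ^ 2 = c * x ^ 2 := congrArg Prod.snd hy
    by_cases hx : x = 0
    · exact Or.inl (by rw [hx, map_zero])
    · right
      have : c * (c - 1) * x ^ 2 = 0 := by rw [h1] at h2; linear_combination h2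
      simpa [hx, sub_eq_zero] using this
  · rw [← Nat.card_congr (AddMonoidHom.ofInjective hφ).toEquiv, Nat.card_prod, sq]

/-- The doubling construction. -/
theorem IsMaxScattered.exists_isCompleteCap [CharP F 2] [Finite F] {m : ℕ}
    {U : AddSubgroup (Fin m → F)} (hU : IsMaxScattered F U) {c : F} (h0 : c ≠ 0) (h1 : c ≠ 1) :
    ∃ K : Set (Fin (m + 1) → F), IsCompleteCap F K ∧ K.ncard = 2 * Nat.card U := by
  let g : F × (Fin m → F) → (Fin (m + 1) → F) := fun p => Fin.cons p.1 p.2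
  have hg : Function.Injective g := by
    rintro ⟨a, b⟩ ⟨a', b'⟩ h
    obtain ⟨h, h'⟩ := Fin.cons_injective2 h
    exact Prod.ext h h'
  have hgadd : ∀ (p p' : F × (Fin m → F)) (l : F), g p + l • (g p' - g p) = g (p + l • (p' - p)) := by
    intro p p' l
    ext i
    refine Fin.cases ?_ (fun j => ?_) i <;> simp [g]
  have hgsurj : ∀ w, ∃ p, g p = w := fun w => ⟨(w 0, Fin.tail w), Fin.cons_self_tail w⟩
  set S : Set (F × (Fin m → F)) := ({0, 1} : Set F) ×ˢ (U : Set (Fin m → F)) with hS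
  refine ⟨g '' S, isCompleteCap_iff.2 ⟨isCap_iff.2 ?_, ?_⟩, ?_⟩
  · rintro _ ⟨⟨z, u⟩, ⟨hz, hu⟩, rfl⟩ _ ⟨⟨z', u'⟩, ⟨hz', hu'⟩, rfl⟩ hne l hl
    rw [hgadd, hg.mem_set_image] at hl
    obtain ⟨hl1, hl2⟩ := hl
    simp only [Prod.fst_add, Prod.smul_fst, Prod.fst_sub, Prod.snd_add, Prod.smul_snd,
      Prod.snd_sub, smul_eq_mul, Set.mem_insert_iff, Set.mem_singleton_iff] at hl1 hl2 hz hz'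
    have hs : z = z' → l = 0 ∨ l = 1 := by
      rintro rfl
      have : l • (u' - u) ∈ U := (U.add_mem_cancel_left hu).1 hl2
      refine (hU.1 _ (U.sub_mem hu' hu) l this).resolve_left fun h => hne ?_
      exact congrArg (fun x => g (z, x)) (sub_eq_zero.1 h).symm
    rcases hz with rfl | rfl <;> rcases hz' with rfl | rfl
    · exact hs rfl
    · simpa using hl1
    · have : 1 - l = 0 ∨ 1 - l = 1 := by simpa [sub_eq_add_neg] using hl1
      rcases this with h | h
      · exact Or.inr (sub_eq_zero.1 h).symm
      · exact Or.inl (by simpa using h)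
    · exact hs rfl
  · intro w hw
    obtain ⟨⟨z, v⟩, rfl⟩ := hgsurj w
    suffices h : ∃ p ∈ S, ∃ p' ∈ S, ∃ l : F, (z, v) = p + l • (p' - p) by
      obtain ⟨p, hp, p', hp', l, h⟩ := h
      refine ⟨g p, ⟨p, hp, rfl⟩, g p', ⟨p', hp', rfl⟩, fun hpp => hw ?_, l, by rw [hgadd, h]⟩
      rw [hg hpp, sub_self, smul_zero, add_zero] at h
      rw [h]
      exact ⟨p', hp', rfl⟩
    by_cases hz : z ∈ ({0, 1} : Set F)
    · obtain ⟨a, ha, b, hb, rfl⟩ := hU.exists_eq_add_smul h0 h1 v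
      exact ⟨(z, a), ⟨hz, ha⟩, (z, a + b), ⟨hz, U.add_mem ha hb⟩, c, by ext <;> simp⟩
    · simp only [Set.mem_insert_iff, Set.mem_singleton_iff, not_or] at hz
      have hz1 : 1 - z ≠ 0 := sub_ne_zero.2 (Ne.symm hz.2)
      -- Off the two layers, v = (1 - z)a + z b is needed with a, b in U; the ratio z/(1 - z) is
      -- never 1 in characteristic 2.
      have hz2 : z / (1 - z) ≠ 1 := by
        intro h
        rw [div_eq_one_iff_eq hz1, CharTwo.sub_eq_add] at h
        simp at h
      obtain ⟨a, ha, b, hb, hab⟩ := hU.exists_eq_add_smul (div_ne_zero hz.1 hz1) hz2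
        ((1 - z)⁻¹ • v)
      refine ⟨(0, a), ⟨by simp, ha⟩, (1, b), ⟨by simp, hb⟩, z, Prod.ext (by simp) ?_⟩
      have : v = (1 - z) • (a + (z / (1 - z)) • b) := by rw [← hab, smul_inv_smul₀ hz1]
      simp only [Prod.snd_add, Prod.smul_snd, Prod.snd_sub]
      rw [this, smul_add, smul_smul, mul_div_cancel₀ _ hz1]
      module
  · rw [Set.ncard_image_of_injective _ hg, hS, Set.ncard_prod, Set.ncard_pair zero_ne_one]
    rfl

end Scattered

/-! ### Rank 3 from semilinear maps -/

section Rank3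

variable {F L : Type*} [Field F] [Field L]

/-- A Frobenius-type semilinear map without invariant subspaces yields a maximum scattered
subgroup over a quadratic extension. -/
theorem exists_isMaxScattered_of_semilinear [Finite F] [Algebra L F] [CharP L 2]
    (hcard : Nat.card F = Nat.card L ^ 2) {ι : Type*} [Finite ι] {σ : L →+* L}
    (hσ : ∀ a, σ a = a → a = 0 ∨ a = 1) (f : (ι → L) →ₛₗ[σ] (ι → L))
    (hf : ∀ x, f x = 0 → x = 0) (hff : ∀ x, x ≠ 0 → ∀ b d : L, d ≠ 0 → f (f x) ≠ b • f x + d • x) :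
    ∃ U : AddSubgroup (ι → F), IsMaxScattered F U := by
  have hinjA := (algebraMap L F).injective
  have : Finite L := Finite.of_injective _ hinjA
  obtain ⟨w, hw⟩ : ∃ w : F, ∀ a : L, algebraMap L F a ≠ w := by
    by_contra! h
    have h1 := Nat.card_le_card_of_surjective _ (show Function.Surjective (algebraMap L F) from h)
    have h2 : 1 < Nat.card L := Finite.one_lt_card
    rw [hcard] at h1
    nlinarith
  have hinj : ∀ a b a' b' : L, algebraMap L F a + w * algebraMap L F b =
      algebraMap L F a' + w * algebraMap L F b' → a = a' ∧ b = b' := by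
    intro a b a' b' h
    have hb : b = b' := by
      by_contra hb
      have hb' : algebraMap L F (b - b') ≠ 0 := by
        simpa [sub_eq_zero] using fun h => hb (hinjA h)
      refine hw ((a' - a) / (b - b')) ?_
      rw [map_div₀, div_eq_iff hb', map_sub, map_sub]
      linear_combination -h
    subst hb
    exact ⟨hinjA (add_right_cancel h), rfl⟩
  have hsurj : ∀ c : F, ∃ a b : L, c = algebraMap L F a + w * algebraMap L F b := by
    let g : L × L → F := fun p => algebraMap L F p.1 + w * algebraMap L F p.2
    have hg : Function.Injective g := fun p p' h => Prod.ext (hinj _ _ _ _ h).1 (hinj _ _ _ _ h).2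
    intro c
    obtain ⟨p, hp⟩ := (hg.bijective_of_nat_card_le (by rw [hcard, Nat.card_prod, sq])).2 c
    exact ⟨p.1, p.2, hp.symm⟩
  obtain ⟨B, A, hBA⟩ := hsurj (w * w)
  have hB : B ≠ 0 := by
    rintro rfl
    have hw0 : w ≠ 0 := fun h => hw 0 (by rw [h, map_zero])
    rw [map_zero, zero_add] at hBA
    exact hw A (mul_left_cancel₀ hw0 hBA).symm
  let φ : (ι → L) →+ (ι → F) :=
    { toFun := fun x i => algebraMap L F (x i) + w * algebraMap L F (f x i)
      map_zero' := by ext; simp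
      map_add' := fun x y => by ext; simp; ring }
  have hφ : Function.Injective φ := fun x y h =>
    funext fun i => (hinj _ _ _ _ (congrFun h i)).1
  refine ⟨φ.range, ?_, ?_⟩
  · rintro _ ⟨y, rfl⟩ c ⟨x, hx⟩
    rw [or_iff_not_imp_left]
    intro hy
    have hy0 : y ≠ 0 := fun h => hy (by rw [h, map_zero])
    obtain ⟨a, b, rfl⟩ := hsurj c
    -- Coordinates over L of x + w f(x) = (a + bw)(y + w f(y)), using w² = B + Aw. If b ≠ 0,
    -- applying f to the first equation puts f(f y) in the span of y and f y, with nonzero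
    -- y-coefficient.
    have key : ∀ i, x i = a * y i + B * b * f y i ∧ f x i = b * y i + (a + A * b) * f y i := by
      intro i
      refine hinj _ _ _ _ ((congrFun hx i).trans ?_)
      change (algebraMap L F a + w * algebraMap L F b) *
        (algebraMap L F (y i) + w * algebraMap L F (f y i)) = _
      simp only [map_add, map_mul]
      linear_combination (algebraMap L F b * algebraMap L F (f y i)) * hBA
    have k1 : x = a • y + (B * b) • f y := funext fun i => (key i).1
    have k2 : f x = b • y + (a + A * b) • f y := funext fun i => (key i).2
    rw [k1, map_add, map_smulₛₗ, map_smulₛₗ] at k2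
    by_cases hb : b = 0
    · subst hb
      have h3 : (σ a - a) • f y = 0 := by
        rw [sub_smul, sub_eq_zero]
        simpa using k2
      rcases smul_eq_zero.1 h3 with h | h
      · rcases hσ a (sub_eq_zero.1 h) with rfl | rfl <;> simp
      · exact absurd (hf y h) hy0
    · exfalso
      set s := σ (B * b) with hs
      have hs0 : s ≠ 0 := by
        rw [hs, Ne, map_eq_zero]
        exact mul_ne_zero hB hb
      refine hff y hy0 (s⁻¹ * (a + A * b - σ a)) (s⁻¹ * b)
        (mul_ne_zero (inv_ne_zero hs0) hb) ?_
      have h4 : s • f (f y) = (a + A * b - σ a) • f y + b • y := by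
        rw [sub_smul, ← sub_eq_zero]
        rw [← sub_eq_zero] at k2
        rw [← k2]
        module
      rw [← inv_smul_smul₀ hs0 (f (f y)), h4, smul_add, smul_smul, smul_smul]
  · rw [← Nat.card_congr (AddMonoidHom.ofInjective hφ).toEquiv, Nat.card_fun, Nat.card_fun,
      hcard, ← pow_mul, ← pow_mul, mul_comm]

/-- The twisted cyclic shift attached to a non-seventh power. -/
theorem exists_semilinear_of_not_pow_seven [CharP L 2] {a : L} (ha : ∀ b, b ^ 7 ≠ a) :
    ∃ f : (Fin 3 → L) →ₛₗ[frobenius L 2] (Fin 3 → L), (∀ x, f x = 0 → x = 0) ∧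
      ∀ x, x ≠ 0 → ∀ b d : L, d ≠ 0 → f (f x) ≠ b • f x + d • x := by
  have ha0 : a ≠ 0 := fun h => ha 0 (by simp [h])
  have ext3 : ∀ u v : Fin 3 → L, u 0 = v 0 → u 1 = v 1 → u 2 = v 2 → u = v := by
    intro u v h0 h1 h2
    ext i
    fin_cases i <;> assumption
  let f : (Fin 3 → L) →ₛₗ[frobenius L 2] (Fin 3 → L) :=
    { toFun := fun v => ![a * v 2 ^ 2, v 0 ^ 2, v 1 ^ 2]
      map_add' := fun u v => ext3 _ _
        (by simp [CharTwo.add_sq, mul_add]) (by simp [CharTwo.add_sq]) (by simp [CharTwo.add_sq])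
      map_smul' := fun c v => ext3 _ _
        (by simp [frobenius_def]; ring) (by simp [frobenius_def]; ring)
        (by simp [frobenius_def]; ring) }
  have f0 : ∀ v, f v 0 = a * v 2 ^ 2 := fun v => rfl
  have f1 : ∀ v, f v 1 = v 0 ^ 2 := fun v => rfl
  have f2 : ∀ v, f v 2 = v 1 ^ 2 := fun v => rfl
  have hf : ∀ x, f x = 0 → x = 0 := by
    intro x hx
    have h0 := congrFun hx 0
    have h1 := congrFun hx 1
    have h2 := congrFun hx 2
    rw [f0] at h0; rw [f1] at h1; rw [f2] at h2
    refine ext3 _ _ ?_ ?_ ?_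
    · simpa using h1
    · simpa using h2
    · simpa [ha0] using h0
  -- An eigenvector would give (l / x 0)^7 = a.
  have heig : ∀ (x : Fin 3 → L) (l : L), x ≠ 0 → f x ≠ l • x := by
    intro x l hx h
    have hl : l ≠ 0 := by
      rintro rfl
      exact hx (hf x (by rw [h, zero_smul]))
    have h0 : a * x 2 ^ 2 = l * x 0 := congrFun h 0
    have h1 : x 0 ^ 2 = l * x 1 := congrFun h 1
    have h2 : x 1 ^ 2 = l * x 2 := congrFun h 2
    have hx0 : x 0 ≠ 0 := by
      intro h00
      have h01 : x 1 = 0 := by simpa [h00, hl] using h1.symm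
      have h02 : x 2 = 0 := by simpa [h01, hl] using h2.symm
      exact hx (ext3 _ _ h00 h01 h02)
    have e1 : x 1 = x 0 ^ 2 / l := by rw [h1, mul_div_cancel_left₀ _ hl]
    have e2 : x 2 = x 0 ^ 4 / l ^ 3 := by
      rw [eq_div_iff (pow_ne_zero 3 hl)]
      linear_combination (-l ^ 2) * h2 - (x 0 ^ 2 + l * x 1) * h1
    refine ha (l / x 0) ?_
    rw [e2] at h0
    field_simp at h0 ⊢
    rw [← h0]
  refine ⟨f, hf, fun x hx b d hd h => ?_⟩
  have two : (2 : L) = 0 := CharTwo.two_eq_zero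
  set u := f x with hu
  have u0 : u 0 = a * x 2 ^ 2 := rfl
  have u1 : u 1 = x 0 ^ 2 := rfl
  have u2 : u 2 = x 1 ^ 2 := rfl
  have w0 : a * u 2 ^ 2 = b * u 0 + d * x 0 := congrFun h 0
  have w1 : u 0 ^ 2 = b * u 1 + d * x 1 := congrFun h 1
  have w2 : u 1 ^ 2 = b * u 2 + d * x 2 := congrFun h 2
  -- An invariant plane is an eigenvector of the induced map on the exterior square: u ∧ f(u) = d (x
  -- ∧ u) in characteristic 2. Its coordinates again yield a seventh root of a, namely a g0 / d.
  have hg0 : d * (x 1 * u 2 - x 2 * u 1) = (x 0 * u 1 - x 1 * u 0) ^ 2 := by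
    linear_combination - u 2 * w1 + u 1 * w2 + u 1 ^ 2 * u1 + u 0 ^ 2 * u2 +
      (x 0 * u 1 * x 1 * u 0 - u 1 ^ 3) * two
  have hg1 : a * (x 1 * u 2 - x 2 * u 1) ^ 2 = d * (x 2 * u 0 - x 0 * u 2) := by
    linear_combination - a * u 2 ^ 2 * u2 - u 1 ^ 2 * u0 + u 0 * w2 - u 2 * w0 +
      (a * u 2 ^ 3 - a * x 1 * x 2 * u 1 * u 2) * two
  have hg2 : a * (x 2 * u 0 - x 0 * u 2) ^ 2 = d * (x 0 * u 1 - x 1 * u 0) := by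
    linear_combination - u 0 ^ 2 * u0 - a * u 2 ^ 2 * u1 + u 1 * w0 - u 0 * w1 +
      (u 0 ^ 3 - a * x 0 * x 2 * u 0 * u 2) * two
  have hpar : ¬ (x 1 * u 2 - x 2 * u 1 = 0 ∧ x 2 * u 0 - x 0 * u 2 = 0 ∧
      x 0 * u 1 - x 1 * u 0 = 0) := by
    rintro ⟨g0, g1, g2⟩
    obtain ⟨j, hj⟩ : ∃ j, x j ≠ 0 := by
      by_contra! h'
      exact hx (funext h')
    refine heig x (u j / x j) hx (funext fun i => ?_)
    rw [Pi.smul_apply, smul_eq_mul, ← hu, div_mul_eq_mul_div, eq_div_iff hj]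
    fin_cases i <;> fin_cases j <;> simp only [Fin.mk_one, Fin.zero_eta, Fin.reduceFinMk] <;>
      first
      | ring1
      | linear_combination g0
      | linear_combination -g0
      | linear_combination g1
      | linear_combination -g1
      | linear_combination g2
      | linear_combination -g2
  generalize x 1 * u 2 - x 2 * u 1 = g0 at *
  generalize x 2 * u 0 - x 0 * u 2 = g1 at *
  generalize x 0 * u 1 - x 1 * u 0 = g2 at *
  have hg00 : g0 ≠ 0 := by
    intro h0
    have h1 : g1 = 0 := by simpa [h0, hd] using hg1.symm
    have h2 : g2 = 0 := by simpa [h1, hd] using hg2.symm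
    exact hpar ⟨h0, h1, h2⟩
  have e1 : g1 = a * g0 ^ 2 / d := by rw [hg1, mul_div_cancel_left₀ _ hd]
  have e2 : g2 = a * g1 ^ 2 / d := by rw [hg2, mul_div_cancel_left₀ _ hd]
  rw [e2, e1] at hg0
  refine ha (a * g0 / d) ?_
  field_simp at hg0 ⊢
  rw [hg0]

end Rank3

/-! ### Seventh powers and the cubic extension -/

section CubicExtension

theorem eq_one_of_pow_seven_eq_one {L : Type*} [Field L] [Finite L] {m : ℕ}
    (hm : Nat.card L = 2 ^ m) (h3 : ¬ 3 ∣ m) {a : L} (ha : a ^ 7 = 1) : a = 1 := by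
  have ha0 : a ≠ 0 := by rintro rfl; simp at ha
  have h1 : a ^ (2 ^ m - 1) = 1 := by
    have := pow_card_eq_one' (x := Units.mk0 a ha0)
    rw [Nat.card_units, hm] at this
    simpa using congrArg Units.val this
  have h2 : Nat.gcd (2 ^ 3 - 1) (2 ^ m - 1) = 1 := by
    rw [Nat.pow_sub_one_gcd_pow_sub_one, show Nat.gcd 3 m = 1 from
      (Nat.Prime.coprime_iff_not_dvd Nat.prime_three).2 h3]
    norm_num
  have := pow_gcd_eq_one.2 ⟨ha, h1⟩
  change a ^ Nat.gcd (2 ^ 3 - 1) _ = 1 at this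
  rwa [h2, pow_one] at this

theorem exists_forall_pow_seven_ne {L : Type*} [Field L] [Finite L] {m : ℕ}
    (hm : Nat.card L = 2 ^ m) (h3 : 3 ∣ m) : ∃ a : L, ∀ b, b ^ 7 ≠ a := by
  by_contra! h
  have hinj : Function.Injective fun b : L => b ^ 7 := Finite.injective_iff_surjective.2 h
  have : Fact (Nat.Prime 7) := ⟨by norm_num⟩
  obtain ⟨z, hz⟩ := exists_prime_orderOf_dvd_card' (G := Lˣ) 7 (by
    rw [Nat.card_units, hm]
    exact Nat.pow_sub_one_dvd_pow_sub_one 2 h3)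
  have hz7 : z ^ 7 = 1 := hz ▸ pow_orderOf_eq_one z
  have hz1 : (z : L) = 1 := hinj (by simpa using congrArg Units.val hz7)
  rw [Units.val_eq_one.1 hz1, orderOf_one] at hz
  norm_num at hz

/-- For a degree not divisible by three, multiplying a third power of Frobenius by a primitive
element of the cubic extension gives a semilinear map without invariant subspaces. -/
theorem exists_semilinear_of_not_three_dvd {L K : Type*} [Field L] [Finite L] [CharP L 2]
    [Field K] [Algebra L K] (hrank : Module.finrank L K = 3) {m : ℕ}
    (hm : Nat.card L = 2 ^ m) (h3 : ¬ 3 ∣ m) :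
    ∃ f : (Fin 3 → L) →ₛₗ[iterateFrobenius L 2 3] (Fin 3 → L), (∀ x, f x = 0 → x = 0) ∧
      ∀ x, x ≠ 0 → ∀ b d : L, d ≠ 0 → f (f x) ≠ b • f x + d • x := by
  classical
  have : Module.Finite L K := Module.finite_of_finrank_pos (by omega)
  have : Finite K := Module.finite_of_finite L
  have : Fintype K := Fintype.ofFinite K
  have hK : Nat.card K = 8 ^ m := by
    rw [Module.natCard_eq_pow_finrank (K := L), hrank, hm, ← pow_mul, mul_comm, pow_mul]
    norm_num
  have : CharP K 2 := charP_of_injective_algebraMap (algebraMap L K).injective 2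
  have hm0 : m ≠ 0 := by rintro rfl; simp at h3
  obtain ⟨θ, hθ⟩ := IsCyclic.exists_generator (α := Kˣ)
  have hord : orderOf θ = 8 ^ m - 1 := by
    rw [orderOf_eq_card_of_forall_mem_zpowers hθ, Nat.card_units, hK]
  set e := ∑ k ∈ Finset.range m, 8 ^ k with he
  have hgeom : 7 * e = 8 ^ m - 1 := by
    have : ∀ k, 7 * ∑ j ∈ Finset.range k, 8 ^ j + 1 = 8 ^ k := by
      intro k
      induction k with
      | zero => simp
      | succ k ih => rw [Finset.sum_range_succ, pow_succ]; omega
    have := this m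
    omega
  -- ν is a nontrivial seventh root of unity, hence outside L, and f^m is multiplication by ν
  -- because x^(8^m) = x on K.
  set ν : Kˣ := θ ^ e with hν
  have hν7 : ν ^ 7 = 1 := by
    rw [hν, ← pow_mul, mul_comm, hgeom, ← hord, pow_orderOf_eq_one]
  have hν1 : ν ≠ 1 := by
    intro h
    have h8 : 1 < 8 ^ m := Nat.one_lt_pow hm0 (by norm_num)
    have := Nat.le_of_dvd (by omega) (orderOf_dvd_of_pow_eq_one h)
    omega
  have hνL : (ν : K) ∉ Set.range (algebraMap L K) := by
    rintro ⟨a, ha⟩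
    have ha7 : a ^ 7 = 1 := (algebraMap L K).injective (by
      rw [map_pow, ha, map_one, ← Units.val_pow_eq_pow_val, hν7, Units.val_one])
    rw [eq_one_of_pow_seven_eq_one hm h3 ha7, map_one] at ha
    exact hν1 (Units.val_eq_one.1 ha.symm)
  let f : K →ₛₗ[iterateFrobenius L 2 3] K :=
    { toFun := fun x => θ * x ^ 8
      map_add' := fun x y => by
        have := add_pow_char_pow x y 2 3
        norm_num at this
        rw [this, mul_add]
      map_smul' := fun c x => by
        rw [iterateFrobenius_def, Algebra.smul_def, Algebra.smul_def, map_pow]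
        ring }
  have hfa : ∀ x, f x = θ * x ^ 8 := fun x => rfl
  have hf0 : ∀ x, f x = 0 → x = 0 := by
    intro x hx
    simpa [hfa] using hx
  have hiter : ∀ k x, f^[k] x = (θ : K) ^ (∑ j ∈ Finset.range k, 8 ^ j) * x ^ 8 ^ k := by
    intro k
    induction k with
    | zero => simp
    | succ k ih =>
      intro x
      rw [Function.iterate_succ_apply', ih, hfa, Finset.sum_range_succ']
      simp only [pow_succ, ← Finset.sum_mul]
      ring
  have hfm : ∀ x, f^[m] x = ν * x := by
    intro x
    rw [hiter, ← he, hν, Units.val_pow_eq_pow_val]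
    rw [← hK, Nat.card_eq_fintype_card, FiniteField.pow_card]
  have hff : ∀ x, x ≠ 0 → ∀ b d : L, d ≠ 0 → f (f x) ≠ b • f x + d • x := by
    intro x hx b d hd h
    -- V is f-invariant, hence closed under L(ν). So [L(ν) : L] ≤ dim V ≤ 2, yet it divides 3, which
    -- would put ν in L.
    let V : Submodule L K := Submodule.span L {x, f x}
    have hxV : x ∈ V := Submodule.subset_span (by simp)
    have hfV : ∀ v ∈ V, f v ∈ V := by
      intro v hv
      obtain ⟨p, r, rfl⟩ := Submodule.mem_span_pair.1 hv
      rw [map_add, map_smulₛₗ, map_smulₛₗ, h]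
      exact V.add_mem (V.smul_mem _ (Submodule.subset_span (by simp)))
        (V.smul_mem _ (V.add_mem (V.smul_mem _ (Submodule.subset_span (by simp)))
          (V.smul_mem _ hxV)))
    have hνV : ∀ v ∈ V, (ν : K) * v ∈ V := by
      intro v hv
      rw [← hfm]
      have : ∀ k, f^[k] v ∈ V := by
        intro k
        induction k with
        | zero => exact hv
        | succ k ih => rw [Function.iterate_succ_apply']; exact hfV _ ih
      exact this m
    have hVdim : Module.finrank L V ≤ 2 :=
      (finrank_span_le_card _).trans (by
        rw [Set.toFinset_insert, Set.toFinset_singleton]; exact Finset.card_le_two)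
    let E := IntermediateField.adjoin L {(ν : K)}
    have hEV : ∀ y ∈ E, y * x ∈ V := by
      intro y hy
      have hy' : y ∈ Algebra.adjoin L {(ν : K)} := by
        rwa [← IntermediateField.adjoin_simple_toSubalgebra_of_isAlgebraic
          (Algebra.IsAlgebraic.isAlgebraic _)]
      suffices h : ∀ v ∈ V, y * v ∈ V from h x hxV
      clear hy
      induction hy' using Algebra.adjoin_induction with
      | mem y hy =>
        rw [Set.mem_singleton_iff.1 hy]
        exact hνV
      | algebraMap r =>
        intro v hv
        rw [← Algebra.smul_def]
        exact V.smul_mem r hv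
      | add y z _ _ h h' =>
        intro v hv
        rw [add_mul]
        exact V.add_mem (h v hv) (h' v hv)
      | mul y z _ _ h h' =>
        intro v hv
        rw [mul_assoc]
        exact h _ (h' v hv)
    have hEle : Module.finrank L E ≤ Module.finrank L V := by
      let g : E →ₗ[L] V := ((LinearMap.mulRight L x).comp E.val.toLinearMap).codRestrict V
        fun y => hEV y y.2
      refine LinearMap.finrank_le_finrank_of_injective (f := g) fun y y' hyy => ?_
      exact Subtype.ext (mul_right_cancel₀ hx (congrArg Subtype.val hyy))
    have hE3 : Module.finrank L E ∣ 3 := by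
      rw [← hrank]
      exact Dvd.intro _ (Module.finrank_mul_finrank L E K)
    have hE1 : Module.finrank L E = 1 := by
      rcases (Nat.dvd_prime Nat.prime_three).1 hE3 with h | h
      · exact h
      · omega
    rw [IntermediateField.finrank_adjoin_simple_eq_one_iff] at hE1
    exact hνL (IntermediateField.mem_bot.1 hE1)
  let ε : K ≃ₗ[L] (Fin 3 → L) := LinearEquiv.ofFinrankEq _ _ (by simp [hrank])
  refine ⟨(ε.toLinearMap.comp f).comp ε.symm.toLinearMap, ?_, ?_⟩
  · intro x hx
    simpa using hf0 (ε.symm x) (by simpa using hx)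
  · intro x hx b d hd h
    refine hff (ε.symm x) (by simpa using hx) b d hd (ε.injective ?_)
    simpa using h

end CubicExtension

/-! ### Assembly -/

theorem charP_two_of_natCard {F : Type*} [Field F] [Finite F] {r : ℕ}
    (hF : Nat.card F = 2 ^ r) : CharP F 2 := by
  have := Fintype.ofFinite F
  exact charP_of_card_eq_prime_pow (f := r) (by rw [← Nat.card_eq_fintype_card, hF])

theorem exists_isMaxScattered_fin_three {F : Type*} [Field F] [Finite F] {m : ℕ}
    (hF : Nat.card F = 2 ^ (2 * m)) (hm : m ≠ 0) :
    ∃ U : AddSubgroup (Fin 3 → F), IsMaxScattered F U := by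
  have : CharP F 2 := charP_two_of_natCard hF
  let L := GaloisField 2 m
  have hL : Nat.card L = 2 ^ m := GaloisField.card 2 m hm
  let _ : Algebra (ZMod 2) F := ZMod.algebra F 2
  have hFr : Module.finrank (ZMod 2) F = 2 * m := by
    have := FiniteField.pow_finrank_eq_natCard 2 F
    rw [hF] at this
    exact Nat.pow_right_injective le_rfl this
  obtain ⟨φ⟩ := FiniteField.nonempty_algHom_of_finrank_dvd (F := ZMod 2) (K := L) (L := F)
    (by rw [hFr, GaloisField.finrank 2 hm]; exact dvd_mul_left _ _)
  let _ : Algebra L F := φ.toRingHom.toAlgebra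
  have hcard : Nat.card F = Nat.card L ^ 2 := by rw [hF, hL, ← pow_mul, mul_comm]
  -- The twist may fix only 0 and 1. Cubed Frobenius does so exactly when 3 ∤ m; when 3 ∣ m, L
  -- contains the field of order 8, but non-seventh powers exist and plain Frobenius works.
  by_cases h3 : 3 ∣ m
  · obtain ⟨a, ha⟩ : ∃ a : L, ∀ b, b ^ 7 ≠ a := exists_forall_pow_seven_ne hL h3
    obtain ⟨f, hf, hff⟩ := exists_semilinear_of_not_pow_seven ha
    refine exists_isMaxScattered_of_semilinear hcard (fun a ha => ?_) f hf hff
    have : a * (a - 1) = 0 := by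
      rw [frobenius_def] at ha
      linear_combination ha
    simpa [sub_eq_zero] using this
  · obtain ⟨f, hf, hff⟩ := exists_semilinear_of_not_three_dvd
      (FiniteField.finrank_extension L 2 3) hL h3
    refine exists_isMaxScattered_of_semilinear hcard (fun a ha => ?_) f hf hff
    rw [iterateFrobenius_def] at ha
    rw [or_iff_not_imp_left]
    intro ha0
    exact eq_one_of_pow_seven_eq_one hL h3 (mul_right_cancel₀ ha0 (by linear_combination ha))

theorem exists_isMaxScattered_of_odd {F : Type*} [Field F] [Finite F] {m : ℕ}
    (hF : Nat.card F = 2 ^ (2 * m)) (hm : m ≠ 0) (k : ℕ) :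
    ∃ U : AddSubgroup (Fin (2 * k + 3) → F), IsMaxScattered F U := by
  have : CharP F 2 := charP_two_of_natCard hF
  induction k with
  | zero => exact exists_isMaxScattered_fin_three hF hm
  | succ k ih =>
    obtain ⟨U, hU⟩ := ih
    obtain ⟨U', hU'⟩ := exists_isMaxScattered_prod_self F
    exact ⟨_, (hU.prod hU').map (LinearEquiv.ofFinrankEq _ _ (by simp; ring))⟩

/-- Here `AG(n,q)` is `Fin n → F` with `F` a (the) field with `q` elements. -/
theorem theorem1p3 (t q n : ℕ) (ht : Even t) (hq : q = 2 ^ t) (hn : 4 ≤ n) (hn' : Even n)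
    (F : Type*) [Field F] [Fintype F] (hF : Fintype.card F = q) :
    (∃ K : Set (Fin n → F),
      IsCompleteCap F K ∧ (K.ncard : ℝ) = 2 * Real.sqrt (q : ℝ) ^ (n - 1)) ∧
    (∀ K : Set (Fin n → F),
      IsCompleteCap F K → Real.sqrt 2 * Real.sqrt (q : ℝ) ^ (n - 1) ≤ (K.ncard : ℝ)) := by
  have hq2 : 2 ≤ q := hF ▸ Fintype.one_lt_card
  obtain ⟨m, hm⟩ := ht
  obtain ⟨k, rfl⟩ : ∃ k, n = 2 * k + 3 + 1 := by
    obtain ⟨j, hj⟩ := hn'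
    exact ⟨j - 2, by omega⟩
  have hm0 : m ≠ 0 := by
    rintro rfl
    simp [hm] at hq
    omega
  have hFc : Nat.card F = 2 ^ (2 * m) := by rw [Nat.card_eq_fintype_card, hF, hq, hm, two_mul]
  rw [Nat.add_sub_cancel]
  have hqpos : (0 : ℝ) < q := by exact_mod_cast (by omega : 0 < q)
  have hsq : (Real.sqrt q ^ (2 * k + 3)) ^ 2 = (q : ℝ) ^ (2 * k + 3) := by
    rw [← pow_mul, mul_comm, pow_mul, Real.sq_sqrt hqpos.le]
  constructor
  · have : CharP F 2 := charP_two_of_natCard hFc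
    obtain ⟨U, hU⟩ := exists_isMaxScattered_of_odd hFc hm0 k
    obtain ⟨c, hc⟩ : ∃ c : F, c ∉ ({0, 1} : Set F) := by
      by_contra! h
      have h1 : (Set.univ : Set F).ncard ≤ ({0, 1} : Set F).ncard :=
        Set.ncard_le_ncard fun c _ => h c
      rw [Set.ncard_univ, hFc, Set.ncard_pair zero_ne_one] at h1
      have h2 : 2 ^ 2 ≤ 2 ^ (2 * m) := Nat.pow_le_pow_right two_pos (by omega)
      omega
    simp only [Set.mem_insert_iff, Set.mem_singleton_iff, not_or] at hc
    obtain ⟨K, hK, hKc⟩ := hU.exists_isCompleteCap hc.1 hc.2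
    refine ⟨K, hK, ?_⟩
    rw [hKc, Nat.cast_mul, Nat.cast_ofNat]
    congr 1
    rw [← sq_eq_sq₀ (by positivity) (by positivity), hsq]
    have := hU.2
    rw [Nat.card_fun, Nat.card_eq_fintype_card (α := F), hF, Nat.card_fin] at this
    exact_mod_cast this
  · intro K hK
    have h := hK.two_mul_card_le (hF ▸ hq2)
    rw [Nat.card_fun, Nat.card_eq_fintype_card (α := F), hF, Nat.card_fin, pow_succ, ← mul_assoc] at h
    have h' := Nat.le_of_mul_le_mul_right h (by omega)
    refine le_of_sq_le_sq ?_ (by positivity)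
    rw [mul_pow, hsq, Real.sq_sqrt (by norm_num)]
    exact_mod_cast h'
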